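/- Let $d,T\ge 1$, let $(\Omega,\mathcal F,\mathbb P)$ be a standard (Borel) probability space, let $G_1,\dots,G_T$ be independent standard Gaussian random vectors in $\mathbb R^d$ on it, and let $\mathcal G_t=\sigma(G_s:s\le t)$. Let $\mathbf L$ be the set of block-lower-triangular matrices $L=(L_{t,s})_{t,s=1}^T$, $L_{t,s}\in\mathbb R^{d\times d}$, $L_{t,s}=0$ for $t<s$. For $a\in(\mathbb R^d)^T$ and $L\in\mathbf L$ let $X=a+LG$ be the process $X_t=a_t+\sum_{s\le t}L_{t,s}G_s$, endowed with the filtration $(\mathcal G_t)_{t=1}^T$. For two such processes $X,Y$ set $$\mathcal{AW}_2(X,Y)=\Big(\inf_{\pi}\int \sum_{t=1}^T|X_t(\omega)-Y_t(\omega')|^2\,\pi(d\omega,d\omega')\Big)^{1/2},$$ where the infimum runs over all bicausal couplings, i.e. probability measures $\pi$ on $\Omega\times\Omega$ with both marginals equal to $\mathbb P$ such that, for all $t$, under $\pi$ the $\sigma$-algebra $\mathcal G_T\otimes\{\emptyset,\Omega\}$ is conditionally independent of $\{\emptyset,\Omega\}\otimes\mathcal G_t$ given $\mathcal G_t\otimes\{\emptyset,\Omega\}$,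 and $\{\emptyset,\Omega\}\otimes\mathcal G_T$ is conditionally independent of $\mathcal G_t\otimes\{\emptyset,\Omega\}$ given $\{\emptyset,\Omega\}\otimes\mathcal G_t$. Let $\mathrm{GP}$ be the set of all processes $a+LG$ ($a\in(\mathbb R^d)^T$, $L\in\mathbf L$) modulo the relation $\mathcal{AW}_2(X,Y)=0$. Then $\mathcal{AW}_2$ induces a (finite) metric on $\mathrm{GP}$, and $(\mathrm{GP},\mathcal{AW}_2)$ is an Alexandrov space with non-negative curvature, that is: 1. it is locally complete (every point has a complete neighbourhood); 2. it is geodesic: for all $x,y$ there is a constant speed geodesic from $x$ to $y$, i.e. a curve $\gamma\colon[0,1]\to\mathrm{GP}$ with $\gamma(0)=x$, $\gamma(1)=y$ and $\mathcal{AW}_2(\gamma(u),\gamma(v))=|u-v|\,\mathcal{AW}_2(x,y)$ for all $u,v\in[0,1]$; 3. for all $x,y,z\in\mathrm{GP}$, every constant speed geodesic $\gamma$ from $x$ to $y$ and every $u\in[0,1]$, $$\mathcal{AW}_2^2(\gamma(u),z)\ \ge\ (1-u)\,\mathcal{AW}_2^2(x,z)+u\,\mathcal{AW}_2^2(y,z)-u(1-u)\,\mathcal{AW}_2^2(x,y).$$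 -/

import Mathlib

open MeasureTheory ProbabilityTheory Set
open scoped ENNReal Topology

/-! ### Bicausal couplings and the adapted Wasserstein distance -/

section AdaptedTransport

variable {Ω Ω' : Type*} [MeasurableSpace Ω] [MeasurableSpace Ω']

/-- `π` is a bicausal coupling of the filtered probability spaces `(Ω, P, ℱ)` and `(Ω', P', 𝒢)`
with time set `{1, …, T}` (modelled by `Fin T`, whose last element is `⊤`):
`π` has marginals `P` and `P'`, and under `π`, for every time `t`, the σ-algebra `ℱ_T` is
conditionally independent of `𝒢_t` given `ℱ_t`, and `𝒢_T` is conditionally independent of `ℱ_t`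
given `𝒢_t`. The σ-algebras of the factors are identified with their preimages under the
coordinate projections of `Ω × Ω'`. For `t = T` both conditions hold trivially. -/
structure IsBicausalCoupling [StandardBorelSpace Ω] [StandardBorelSpace Ω'] {T : ℕ} [NeZero T]
    (P : Measure Ω) (ℱ : Filtration (Fin T) (inferInstance : MeasurableSpace Ω))
    (P' : Measure Ω') (𝒢 : Filtration (Fin T) (inferInstance : MeasurableSpace Ω'))
    (π : Measure (Ω × Ω')) [IsFiniteMeasure π] : Prop where
  map_fst : π.map Prod.fst = P
  map_snd : π.map Prod.snd = P'
  causal : ∀ t : Fin T,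
    CondIndep ((ℱ t).comap Prod.fst) ((ℱ ⊤).comap Prod.fst) ((𝒢 t).comap Prod.snd)
      ((MeasurableSpace.comap_mono (ℱ.le t)).trans measurable_fst.comap_le) π
  anticausal : ∀ t : Fin T,
    CondIndep ((𝒢 t).comap Prod.snd) ((𝒢 ⊤).comap Prod.snd) ((ℱ t).comap Prod.fst)
      ((MeasurableSpace.comap_mono (𝒢.le t)).trans measurable_snd.comap_le) π

/-- The adapted Wasserstein distance of order two between the `ℝ^d`-valued processes `X` on
`(Ω, P, ℱ)` and `Y` on `(Ω', P', 𝒢)`: the square root of the infimum of `E_π |X - Y|²` over all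
bicausal couplings `π`, where `|x|² = ∑ t, |x_t|²` on `(ℝ^d)^T`. -/
noncomputable def adaptedWasserstein [StandardBorelSpace Ω] [StandardBorelSpace Ω']
    {d T : ℕ} [NeZero T]
    (P : Measure Ω) (ℱ : Filtration (Fin T) (inferInstance : MeasurableSpace Ω))
    (X : Fin T → Ω → EuclideanSpace ℝ (Fin d))
    (P' : Measure Ω') (𝒢 : Filtration (Fin T) (inferInstance : MeasurableSpace Ω'))
    (Y : Fin T → Ω' → EuclideanSpace ℝ (Fin d)) : ℝ≥0∞ :=
  (⨅ (π : ProbabilityMeasure (Ω × Ω'))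
     (_ : IsBicausalCoupling P ℱ P' 𝒢 (π : Measure (Ω × Ω'))),
      ∫⁻ p, ∑ t, ‖X t p.1 - Y t p.2‖ₑ ^ 2 ∂(π : Measure (Ω × Ω'))) ^ (1 / 2 : ℝ)

end AdaptedTransport

/-! ### Gaussian processes -/

section GaussianProcesses

variable {Ω : Type*} [MeasurableSpace Ω] {d T : ℕ}

/-- The set `𝐋` of block-lower-triangular matrices with `T × T` blocks of size `d × d`. -/
def blockLower (d T : ℕ) : Set (Matrix (Fin T) (Fin T) (Matrix (Fin d) (Fin d) ℝ)) :=
  {L | ∀ t s, t < s → L t s = 0}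

/-- The process `X = a + L G`, that is, `X_t = a_t + ∑ s, L_{t,s} G_s`. -/
noncomputable def affineProcess (G : Fin T → Ω → EuclideanSpace ℝ (Fin d))
    (a : Fin T → EuclideanSpace ℝ (Fin d))
    (L : Matrix (Fin T) (Fin T) (Matrix (Fin d) (Fin d) ℝ)) :
    Fin T → Ω → EuclideanSpace ℝ (Fin d) :=
  fun t ω => a t + ∑ s, Matrix.toEuclideanLin (L t s) (G s ω)

/-- The processes `a + L G` with `a ∈ (ℝ^d)^T` and `L ∈ 𝐋`. -/
def gaussianProcesses (G : Fin T → Ω → EuclideanSpace ℝ (Fin d)) :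
    Set (Fin T → Ω → EuclideanSpace ℝ (Fin d)) :=
  {X | ∃ a, ∃ L ∈ blockLower d T, X = affineProcess G a L}

/-- The filtration `𝒢_t = σ(G_s : s ≤ t)`. -/
def generatedFiltration (G : Fin T → Ω → EuclideanSpace ℝ (Fin d))
    (hG : ∀ t, Measurable (G t)) :
    Filtration (Fin T) (inferInstance : MeasurableSpace Ω) :=
  Filtration.natural G fun t => (hG t).stronglyMeasurable

/-- The adapted Wasserstein distance between two processes on `(Ω, P)` that are both endowed with
the filtration generated by `G`. -/
noncomputable def gaussianAW [StandardBorelSpace Ω] [NeZero T] (P : Measure Ω)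
    (G : Fin T → Ω → EuclideanSpace ℝ (Fin d)) (hG : ∀ t, Measurable (G t))
    (X Y : Fin T → Ω → EuclideanSpace ℝ (Fin d)) : ℝ≥0∞ :=
  adaptedWasserstein P (generatedFiltration G hG) X P (generatedFiltration G hG) Y

/-- The space `GP`: Gaussian processes `a + L G`, modulo vanishing adapted Wasserstein distance. -/
def GaussianProcessSpace [StandardBorelSpace Ω] [NeZero T] (P : Measure Ω)
    (G : Fin T → Ω → EuclideanSpace ℝ (Fin d)) (hG : ∀ t, Measurable (G t)) : Type _ :=
  Quot fun X Y : gaussianProcesses G => gaussianAW P G hG X.1 Y.1 = 0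

/-- The class in `GP` of a Gaussian process. -/
def GaussianProcessSpace.mk [StandardBorelSpace Ω] [NeZero T] (P : Measure Ω)
    (G : Fin T → Ω → EuclideanSpace ℝ (Fin d)) (hG : ∀ t, Measurable (G t))
    (X : gaussianProcesses G) : GaussianProcessSpace P G hG :=
  Quot.mk _ X

end GaussianProcesses

/-! ### Alexandrov spaces of non-negative curvature -/

section Alexandrov

variable {S : Type*} [MetricSpace S]

/-- `γ`, restricted to `[0, 1]`, is a constant speed geodesic from `x` to `y`. -/
def IsConstantSpeedGeodesic (γ : ℝ → S) (x y : S) : Prop :=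
  γ 0 = x ∧ γ 1 = y ∧
    ∀ u ∈ Icc (0 : ℝ) 1, ∀ v ∈ Icc (0 : ℝ) 1, dist (γ u) (γ v) = |u - v| * dist x y

variable (S) in
/-- A metric space is an Alexandrov space with non-negative curvature if it is locally complete,
geodesic, and its squared distance functions satisfy the semi-concavity inequality along every
constant speed geodesic. -/
structure IsNonnegCurvedAlexandrov : Prop where
  locally_complete : ∀ x : S, ∃ U ∈ 𝓝 x, IsComplete U
  geodesic : ∀ x y : S, ∃ γ : ℝ → S, IsConstantSpeedGeodesic γ x y
  semiconcave : ∀ (x y z : S) (γ : ℝ → S), IsConstantSpeedGeodesic γ x y →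
    ∀ u ∈ Icc (0 : ℝ) 1,
      (1 - u) * dist x z ^ 2 + u * dist y z ^ 2 - u * (1 - u) * dist x y ^ 2 ≤
        dist (γ u) z ^ 2

end Alexandrov

/-! A process `a + L G` is encoded by its parameter `v = (a, L)`, a point of a finite-dimensional
Euclidean space with the Frobenius norm. The adapted Wasserstein distance is then the quotient
distance for an isometric action of `O(d)^T`, and such quotients are non-negatively curved.

Bicausality forces the cross-covariance of the two noises to be block-diagonal: causality kills the
blocks on one side of the diagonal and anticausality those on the other. The diagonal blocks `C s`
are contractions by Cauchy–Schwarz, and the cost is `‖v‖² + ‖w‖² - 2⟪v, rotate C w⟫`, affine in `C`.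
By the singular value decomposition an affine function on contractions is optimized at an orthogonal
matrix. Conversely, every orthogonal block-diagonal `O` is the covariance of a bicausal coupling,
under which the second noise is `Oᵀ G`. Hence the distance equals `min_O ‖v - rotate O w‖`
(`gaussianAW_gaussianPath`).

The map from parameters to classes is therefore 1-Lipschitz, and distances are attained by suitable
lifts. `isNonnegCurvedAlexandrov_of_submetry` deduces the curvature bound: lift the endpoints of a
geodesic and the third point optimally relative to a lift of `γ u`, then compare with Stewart's
identity upstairs. -/

/-! ### Submetries of Euclidean spaces and curvature. -/

section Submetry

variable {H S : Type*} [NormedAddCommGroup H] [InnerProductSpace ℝ H]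

/-- Stewart's identity in an inner product space. -/
lemma norm_sub_segment_sq (a x y : H) (u : ℝ) :
    ‖a - ((1 - u) • x + u • y)‖ ^ 2 =
      (1 - u) * ‖a - x‖ ^ 2 + u * ‖a - y‖ ^ 2 - u * (1 - u) * ‖x - y‖ ^ 2 := by
  have h1 : a - ((1 - u) • x + u • y) = (1 - u) • (a - x) + u • (a - y) := by module
  have h2 : x - y = (a - y) - (a - x) := by abel
  rw [h1, h2, norm_add_sq_real, norm_sub_sq_real (a - y), norm_smul, norm_smul, inner_smul_left,
    inner_smul_right, mul_pow, mul_pow, Real.norm_eq_abs, Real.norm_eq_abs, sq_abs, sq_abs,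
    real_inner_comm (a - x) (a - y)]
  simp only [conj_trivial]
  ring

variable [MetricSpace S]

/-- A metric space which is the image of a Euclidean space under a `1`-Lipschitz map such that
distances in the image are realized by suitable lifts is non-negatively curved. -/
theorem isNonnegCurvedAlexandrov_of_submetry [FiniteDimensional ℝ H] (q : H → S)
    (hq : Function.Surjective q) (hle : ∀ x y, dist (q x) (q y) ≤ ‖x - y‖)
    (hlift : ∀ x y, ∃ y', q y' = q y ∧ ‖x - y'‖ = dist (q x) (q y)) :
    IsNonnegCurvedAlexandrov S where
  locally_complete s := by
    obtain ⟨x, rfl⟩ := hq s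
    have hcont : Continuous q :=
      (LipschitzWith.mk_one fun x y => (hle x y).trans_eq (dist_eq_norm x y).symm).continuous
    have : ProperSpace H := FiniteDimensional.proper ℝ H
    refine ⟨Metric.closedBall (q x) 1, Metric.closedBall_mem_nhds _ one_pos, ?_⟩
    -- Optimal lifts make closed balls downstairs images of compact balls, hence complete.
    have himage : Metric.closedBall (q x) 1 = q '' Metric.closedBall x 1 := by
      ext s
      constructor
      · intro hs
        obtain ⟨y, rfl⟩ := hq s
        obtain ⟨y', hy', hd⟩ := hlift x y
        refine ⟨y', ?_, hy'⟩
        rw [Metric.mem_closedBall, dist_comm, dist_eq_norm, hd, dist_comm]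
        exact hs
      · rintro ⟨y, hy, rfl⟩
        rw [Metric.mem_closedBall, dist_eq_norm] at hy
        exact (hle y x).trans hy
    rw [himage]
    exact ((isCompact_closedBall x 1).image hcont).isComplete
  geodesic s s' := by
    obtain ⟨x, rfl⟩ := hq s
    obtain ⟨y', rfl⟩ := hq s'
    obtain ⟨y, hy, hd⟩ := hlift x y'
    rw [← hy] at hd ⊢
    -- The geodesic is the image of the segment between optimally aligned lifts. It is Lipschitz
    -- with the right constant, and the triangle inequality through its endpoints then forces
    -- equality.
    refine ⟨fun u => q ((1 - u) • x + u • y), by simp, by simp, ?_⟩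
    have hupper : ∀ u v : ℝ, dist (q ((1 - u) • x + u • y)) (q ((1 - v) • x + v • y)) ≤
        |u - v| * dist (q x) (q y) := fun u v => by
      refine (hle _ _).trans_eq ?_
      rw [show (1 - u) • x + u • y - ((1 - v) • x + v • y) = (v - u) • (x - y) by module,
        norm_smul, hd, Real.norm_eq_abs, abs_sub_comm]
    have hordered : ∀ u v : ℝ, 0 ≤ u → u ≤ v → v ≤ 1 →
        dist (q ((1 - u) • x + u • y)) (q ((1 - v) • x + v • y)) = |u - v| * dist (q x) (q y) := by
      intro u v hu huv hv
      refine le_antisymm (hupper u v) ?_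
      have h0 := hupper 0 u
      have h1 := hupper v 1
      simp only [sub_zero, one_smul, zero_smul, add_zero, sub_self, zero_add, zero_sub, abs_neg,
        abs_of_nonneg hu, abs_of_nonpos (sub_nonpos.2 hv)] at h0 h1
      have htri := dist_triangle4 (q x) (q ((1 - u) • x + u • y)) (q ((1 - v) • x + v • y)) (q y)
      rw [abs_of_nonpos (sub_nonpos.2 huv)]
      linarith
    intro u hu v hv
    rcases le_total u v with h | h
    · exact hordered u v hu.1 h hv.2
    · rw [dist_comm, abs_sub_comm]
      exact hordered v u hv.1 h hu.2
  semiconcave s s' s'' γ := by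
    rintro ⟨h0, h1, hγ⟩ u hu
    obtain ⟨p, hp⟩ := hq (γ u)
    obtain ⟨x', rfl⟩ := hq s
    obtain ⟨y', rfl⟩ := hq s'
    obtain ⟨z', rfl⟩ := hq s''
    -- All three points are lifted relative to the same `p` above `γ u`.
    obtain ⟨x, hx, hpx⟩ := hlift p x'
    obtain ⟨y, hy, hpy⟩ := hlift p y'
    obtain ⟨z, hz, hpz⟩ := hlift p z'
    rw [← hx, ← hy] at hγ
    rw [← hx] at hpx h0 ⊢
    rw [← hy] at hpy h1 ⊢
    rw [← hz] at hpz ⊢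
    have hu0 := hu.1
    have hu1 := sub_nonneg.2 hu.2
    rw [hp, ← h0, hγ u hu 0 (by simp), sub_zero, abs_of_nonneg hu0] at hpx
    rw [hp, ← h1, hγ u hu 1 (by simp), abs_of_nonpos (by linarith)] at hpy
    have hxy := hle x y
    have hD : 0 ≤ dist (q x) (q y) := dist_nonneg
    -- By Stewart the squared distance of the two sides is `u (1 - u) (dist (q x) (q y) ^ 2 - ‖x -
    -- y‖ ^ 2)`, which is nonpositive since `q` is 1-Lipschitz.
    have hpeq : p = (1 - u) • x + u • y := by
      rw [← sub_eq_zero, ← norm_eq_zero, ← sq_nonpos_iff, norm_sub_segment_sq, hpx, hpy]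
      have hsq : dist (q x) (q y) ^ 2 ≤ ‖x - y‖ ^ 2 := by gcongr
      nlinarith [mul_le_mul_of_nonneg_left hsq (mul_nonneg hu0 hu1)]
    have hub : ‖x - y‖ ≤ dist (q x) (q y) := by
      have := norm_sub_le_norm_sub_add_norm_sub x p y
      rw [norm_sub_rev x p, hpx, hpy] at this
      linarith
    have hsq : ‖x - y‖ ^ 2 = dist (q x) (q y) ^ 2 := by rw [le_antisymm hub hxy]
    rw [← hp, ← hpz, norm_sub_rev, hpeq, norm_sub_segment_sq, hsq]
    have hxz : dist (q x) (q z) ^ 2 ≤ ‖z - x‖ ^ 2 := by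
      rw [norm_sub_rev]; gcongr; exact hle x z
    have hyz : dist (q y) (q z) ^ 2 ≤ ‖z - y‖ ^ 2 := by
      rw [norm_sub_rev]; gcongr; exact hle y z
    nlinarith [mul_le_mul_of_nonneg_left hxz hu1, mul_le_mul_of_nonneg_left hyz hu0]

end Submetry

/-! ### Singular values and optimal orthogonal matrices. -/

section OptimalRotation

open scoped RealInnerProductSpace

/-- Singular value decomposition of an endomorphism of a finite-dimensional inner product space. -/
lemma LinearMap.exists_orthonormalBasis_apply_eq_smul {E : Type*} [NormedAddCommGroup E]
    [InnerProductSpace ℝ E] [FiniteDimensional ℝ E] {d : ℕ} (hd : Module.finrank ℝ E = d)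
    (S : E →ₗ[ℝ] E) :
    ∃ (e b : OrthonormalBasis (Fin d) ℝ E) (σ : Fin d → ℝ),
      (∀ k, 0 ≤ σ k) ∧ ∀ k, S (e k) = σ k • b k := by
  have hsymm : (S.adjoint ∘ₗ S).IsSymmetric := fun x y => by
    simp [LinearMap.adjoint_inner_left, LinearMap.adjoint_inner_right]
  let e := hsymm.eigenvectorBasis hd
  have horth : ∀ k l, k ≠ l → ⟪S (e k), S (e l)⟫ = 0 := fun k l hkl => by
    rw [← LinearMap.adjoint_inner_right, ← LinearMap.comp_apply,
      hsymm.apply_eigenvectorBasis hd l, inner_smul_right, e.orthonormal.2 hkl, mul_zero]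
  -- The images of the eigenvectors of `S* S` are orthogonal. Only the nonzero ones are normalized;
  -- the remaining `b k` may be arbitrary, since there `σ k = 0`.
  let f : Fin d → E := fun k => ‖S (e k)‖⁻¹ • S (e k)
  let J : Set (Fin d) := {k | S (e k) ≠ 0}
  have hf : Orthonormal ℝ (J.domRestrict f) := by
    constructor
    · rintro ⟨k, hk⟩
      have : ‖S (e k)‖ ≠ 0 := norm_ne_zero_iff.2 hk
      simp [f, norm_smul, this]
    · rintro ⟨k, hk⟩ ⟨l, hl⟩ hkl
      have : k ≠ l := fun h => hkl (Subtype.ext h)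
      simp [f, inner_smul_left, inner_smul_right, horth k l this]
  obtain ⟨b, hb⟩ := hf.exists_orthonormalBasis_extension_of_card_eq (by simpa using hd)
  refine ⟨e, b, fun k => ‖S (e k)‖, fun k => norm_nonneg _, fun k => ?_⟩
  by_cases hk : S (e k) = 0
  · simp [hk]
  · rw [hb k hk, smul_smul, mul_inv_cancel₀ (norm_ne_zero_iff.2 hk), one_smul]

/-- A linear functional on matrices is maximized over the contractions by an orthogonal matrix. -/
lemma Matrix.exists_orthogonal_forall_contraction_le {d : ℕ} (A : Matrix (Fin d) (Fin d) ℝ) :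
    ∃ O ∈ Matrix.orthogonalGroup (Fin d) ℝ, ∀ C : Matrix (Fin d) (Fin d) ℝ,
      (∀ x y : EuclideanSpace ℝ (Fin d),
        ∑ i, ∑ j, x i * y j * C i j ≤ (‖x‖ ^ 2 + ‖y‖ ^ 2) / 2) →
      ∑ i, ∑ j, A i j * C i j ≤ ∑ i, ∑ j, A i j * O i j := by
  obtain ⟨e, b, σ, hσ, hA⟩ := LinearMap.exists_orthonormalBasis_apply_eq_smul
    (finrank_euclideanSpace_fin (𝕜 := ℝ) (n := d)) (Matrix.toEuclideanLin A)
  have hentry : ∀ i j, A i j = ∑ k, σ k * (b k i * e k j) := fun i j => by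
    have h1 : Matrix.toEuclideanLin A (EuclideanSpace.single j 1) i = A i j := by
      simp [Matrix.toLpLin_apply]
    rw [← h1, ← e.sum_repr' (EuclideanSpace.single j 1)]
    simp only [map_sum, map_smul, hA, EuclideanSpace.inner_single_right, WithLp.ofLp_sum,
      WithLp.ofLp_smul, Finset.sum_apply, Pi.smul_apply, smul_eq_mul]
    refine Finset.sum_congr rfl fun k _ => ?_
    simp
    ring
  have hsum : ∀ C : Matrix (Fin d) (Fin d) ℝ, ∑ i, ∑ j, A i j * C i j =
      ∑ k, σ k * ∑ i, ∑ j, b k i * e k j * C i j := fun C => by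
    simp only [hentry, Finset.sum_mul, Finset.mul_sum]
    symm
    rw [Finset.sum_comm]
    refine Finset.sum_congr rfl fun i _ => ?_
    rw [Finset.sum_comm]
    exact Finset.sum_congr rfl fun j _ => Finset.sum_congr rfl fun k _ => (mul_assoc _ _ _).symm
  have hdot : ∀ (a : OrthonormalBasis (Fin d) ℝ (EuclideanSpace ℝ (Fin d))) (k l : Fin d),
      ∑ j, a k j * a l j = if k = l then 1 else 0 := fun a k l => by
    rw [← orthonormal_iff_ite.1 a.orthonormal k l, PiLp.inner_apply]
    simp [mul_comm]
  -- As `A = ∑ σ k • b k (e k)ᵀ`, the maximizer is the polar factor `∑ b k (e k)ᵀ = B Eᵀ`. It pairs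
  -- to `1` with each `b k (e k)ᵀ`, while a contraction pairs to at most `1`.
  let B := (EuclideanSpace.basisFun (Fin d) ℝ).toBasis.toMatrix b
  let E := (EuclideanSpace.basisFun (Fin d) ℝ).toBasis.toMatrix e
  have hO : ∀ i j, (B * star E) i j = ∑ l, b l i * e l j := fun i j => by
    simp [B, E, Matrix.mul_apply, Module.Basis.toMatrix_apply, Matrix.star_apply]
  refine ⟨B * star E, mul_mem
    ((EuclideanSpace.basisFun (Fin d) ℝ).toMatrix_orthonormalBasis_mem_orthogonal b)
    (Unitary.star_mem
      ((EuclideanSpace.basisFun (Fin d) ℝ).toMatrix_orthonormalBasis_mem_orthogonal e)),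
    fun C hC => ?_⟩
  rw [hsum, hsum]
  refine Finset.sum_le_sum fun k _ => mul_le_mul_of_nonneg_left ?_ (hσ k)
  have hrow : ∀ i, ∑ j, b k i * e k j * (B * star E) i j = b k i * b k i := fun i => by
    simp only [hO, mul_assoc, ← Finset.mul_sum]
    simp only [Finset.mul_sum, mul_left_comm (e k _)]
    rw [Finset.sum_comm]
    simp [← Finset.mul_sum, hdot e k]
  simp only [hrow]
  rw [hdot b k k, if_pos rfl]
  refine (hC (b k) (e k)).trans ?_
  simp

end OptimalRotation

/-! ### Parameters and the action of block-diagonal matrices. -/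

section ParameterSpace

open scoped RealInnerProductSpace

variable {d T : ℕ}

/-- The space of parameters of Gaussian processes: the coordinate `(t, none)` is the mean `a_t`, and
the coordinate `(t, some (s, i))` is the `i`-th column of the block `L_{t,s}`. -/
abbrev gaussianParams (d T : ℕ) : Submodule ℝ
    (PiLp 2 fun _ : Fin T × Option (Fin T × Fin d) => EuclideanSpace ℝ (Fin d)) where
  carrier := {v | ∀ t s i, t < s → v (t, some (s, i)) = 0}
  add_mem' hv hw t s i h := by simp [hv t s i h, hw t s i h]
  zero_mem' := by simp
  smul_mem' c v hv t s i h := by simp [hv t s i h]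

/-- Right multiplication of the matrix `L` by the transpose of the block-diagonal matrix `O`. -/
noncomputable def rotate (O : Fin T → Matrix (Fin d) (Fin d) ℝ) (v : gaussianParams d T) :
    gaussianParams d T :=
  ⟨WithLp.toLp 2 fun k => k.2.elim (v.1 (k.1, none))
    fun l => ∑ j, O l.1 l.2 j • v.1 (k.1, some (l.1, j)),
    fun t s i h => by simp [v.2 t s _ h]⟩

@[simp]
lemma rotate_apply_none (O : Fin T → Matrix (Fin d) (Fin d) ℝ) (v : gaussianParams d T)
    (t : Fin T) : (rotate O v).1 (t, none) = v.1 (t, none) := rfl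

@[simp]
lemma rotate_apply_some (O : Fin T → Matrix (Fin d) (Fin d) ℝ) (v : gaussianParams d T)
    (t s : Fin T) (i : Fin d) :
    (rotate O v).1 (t, some (s, i)) = ∑ j, O s i j • v.1 (t, some (s, j)) := rfl

lemma gaussianParams.ext {v w : gaussianParams d T} (h₀ : ∀ t, v.1 (t, none) = w.1 (t, none))
    (h₁ : ∀ t s i, v.1 (t, some (s, i)) = w.1 (t, some (s, i))) : v = w := by
  refine Subtype.ext (PiLp.ext ?_)
  rintro ⟨t, _ | ⟨s, i⟩⟩
  exacts [h₀ t, h₁ t s i]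

lemma rotate_one (v : gaussianParams d T) : rotate 1 v = v :=
  gaussianParams.ext (fun _ => rfl) fun t s i => by simp [Matrix.one_apply, ite_smul]

lemma rotate_mul (O O' : Fin T → Matrix (Fin d) (Fin d) ℝ) (v : gaussianParams d T) :
    rotate (O * O') v = rotate O (rotate O' v) :=
  gaussianParams.ext (fun _ => rfl) fun t s i => by
    simp only [rotate_apply_some, Pi.mul_apply, Matrix.mul_apply, Finset.sum_smul,
      Finset.smul_sum, smul_smul]
    exact Finset.sum_comm

lemma rotate_sub (O : Fin T → Matrix (Fin d) (Fin d) ℝ) (v w : gaussianParams d T) :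
    rotate O (v - w) = rotate O v - rotate O w :=
  gaussianParams.ext (fun t => by simp) fun t s i => by
    simp [smul_sub, Finset.sum_sub_distrib]

lemma inner_gaussianParams (v w : gaussianParams d T) :
    ⟪v, w⟫ = ∑ t, (⟪v.1 (t, none), w.1 (t, none)⟫ +
      ∑ s, ∑ i, ⟪v.1 (t, some (s, i)), w.1 (t, some (s, i))⟫) := by
  simp [Submodule.coe_inner, PiLp.inner_apply, Fintype.sum_prod_type, Fintype.sum_option]

lemma inner_rotate (O : Fin T → Matrix (Fin d) (Fin d) ℝ) (v w : gaussianParams d T) :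
    ⟪v, rotate O w⟫ = ∑ t, (⟪v.1 (t, none), w.1 (t, none)⟫ +
      ∑ s, ∑ i, ∑ j, O s i j * ⟪v.1 (t, some (s, i)), w.1 (t, some (s, j))⟫) := by
  rw [inner_gaussianParams]
  simp [inner_sum, inner_smul_right]

/-- The adjoint of `rotate O` is `rotate (star O)`, which is its inverse when the blocks are
orthogonal. -/
lemma norm_rotate {O : Fin T → Matrix (Fin d) (Fin d) ℝ}
    (hO : ∀ s, O s ∈ Matrix.orthogonalGroup (Fin d) ℝ) (v : gaussianParams d T) :
    ‖rotate O v‖ = ‖v‖ := by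
  have hadj : ∀ v w : gaussianParams d T,
      ⟪rotate O v, w⟫ = ⟪v, rotate (star O) w⟫ := fun v w => by
    rw [real_inner_comm, inner_rotate, inner_rotate]
    refine Finset.sum_congr rfl fun t _ => ?_
    rw [real_inner_comm]
    congr 1
    refine Finset.sum_congr rfl fun s _ => ?_
    rw [Finset.sum_comm]
    simp [Matrix.star_apply, real_inner_comm]
  have hstar : star O * O = 1 := funext fun s => (Matrix.mem_orthogonalGroup_iff' _ _).1 (hO s)
  rw [← sq_eq_sq₀ (norm_nonneg _) (norm_nonneg _), ← real_inner_self_eq_norm_sq, hadj,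
    ← rotate_mul, hstar, rotate_one, real_inner_self_eq_norm_sq]

/-- Among all block-diagonal contractions, the correlation of two parameters is maximized by an
orthogonal one. -/
lemma exists_optimal_rotation (v w : gaussianParams d T) :
    ∃ O : Fin T → Matrix (Fin d) (Fin d) ℝ, (∀ s, O s ∈ Matrix.orthogonalGroup (Fin d) ℝ) ∧
      ∀ C : Fin T → Matrix (Fin d) (Fin d) ℝ,
        (∀ s, ∀ x y : EuclideanSpace ℝ (Fin d),
          ∑ i, ∑ j, x i * y j * C s i j ≤ (‖x‖ ^ 2 + ‖y‖ ^ 2) / 2) →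
        ⟪v, rotate C w⟫ ≤ ⟪v, rotate O w⟫ := by
  choose O hO hmax using fun s : Fin T => Matrix.exists_orthogonal_forall_contraction_le
    (Matrix.of fun i j => ∑ t, ⟪v.1 (t, some (s, i)), w.1 (t, some (s, j))⟫)
  refine ⟨O, hO, fun C hC => ?_⟩
  -- The correlation is a constant plus a sum of linear functionals of the separate blocks `C s`, so
  -- each block can be optimized on its own.
  have key : ∀ C : Fin T → Matrix (Fin d) (Fin d) ℝ, ⟪v, rotate C w⟫ =
      ∑ t, ⟪v.1 (t, none), w.1 (t, none)⟫ + ∑ s, ∑ i, ∑ j,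
        (Matrix.of fun i j => ∑ t, ⟪v.1 (t, some (s, i)), w.1 (t, some (s, j))⟫) i j * C s i j := by
    intro C
    rw [inner_rotate, Finset.sum_add_distrib, Finset.sum_comm]
    congr 1
    refine Finset.sum_congr rfl fun s _ => ?_
    rw [Finset.sum_comm]
    refine Finset.sum_congr rfl fun i _ => ?_
    rw [Finset.sum_comm]
    refine Finset.sum_congr rfl fun j _ => ?_
    rw [Matrix.of_apply, Finset.sum_mul]
    exact Finset.sum_congr rfl fun t _ => mul_comm _ _
  rw [key C, key O]
  exact add_le_add le_rfl (Finset.sum_le_sum fun s _ => hmax s (C s) (hC s))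

end ParameterSpace

/-! ### Couplings, conditional independence and second moments. -/

section Probability

/-- If `g` and `h` have the same law under `P`, there is a self-coupling of `P` under which
`g` of the second coordinate agrees with `h` of the first one. -/
lemma exists_coupling_of_map_eq {Ω Z : Type*} [MeasurableSpace Ω] [StandardBorelSpace Ω]
    [MeasurableSpace Z] [MeasurableEq Z] (P : Measure Ω) [IsProbabilityMeasure P]
    {g h : Ω → Z} (hg : Measurable g) (hh : Measurable h) (hgh : P.map g = P.map h) :
    ∃ π : ProbabilityMeasure (Ω × Ω), (π : Measure (Ω × Ω)).map Prod.fst = P ∧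
      (π : Measure (Ω × Ω)).map Prod.snd = P ∧ ∀ᵐ p ∂(π : Measure (Ω × Ω)), g p.2 = h p.1 := by
  have : Nonempty Ω := nonempty_of_isProbabilityMeasure P
  -- Draw `ω` from `P`, then the second coordinate from the conditional law of `P` given `g = h ω`.
  -- Equality of the laws of `g` and `h` makes the second marginal `P`.
  let κ := condDistrib (id : Ω → Ω) g P
  let π : Measure (Ω × Ω) := P ⊗ₘ κ.comap h hh
  have hjoint : π.map (Prod.map h id) = P.map fun ω => (g ω, ω) := by
    have h1 := compProd_map_condDistrib (mβ := inferInstance) (X := g)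
      (Y := (id : Ω → Ω)) (μ := P) aemeasurable_id
    simp only [id] at h1
    rw [← h1]
    ext s hs
    have hm : Measurable fun z => κ z (Prod.mk z ⁻¹' s) := Kernel.measurable_kernel_prodMk_left hs
    rw [Measure.map_apply (hh.prodMap measurable_id) hs,
      Measure.compProd_apply (hh.prodMap measurable_id hs), Measure.compProd_apply hs, hgh,
      lintegral_map hm hh]
    rfl
  refine ⟨⟨π, inferInstance⟩, ?_, ?_, ?_⟩
  · exact Measure.fst_compProd P _
  · have h2 : π.map Prod.snd = (π.map (Prod.map h id)).map Prod.snd := by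
      rw [Measure.map_map measurable_snd (hh.prodMap measurable_id)]
      rfl
    change π.map Prod.snd = P
    rw [h2, hjoint, Measure.map_map measurable_snd (hg.prodMk measurable_id')]
    exact Measure.map_id
  · have hs : MeasurableSet {q : Z × Ω | g q.2 = q.1} :=
      measurableSet_eq_fun (hg.comp measurable_snd) measurable_fst
    have h3 : ∀ᵐ q ∂π.map (Prod.map h id), g q.2 = q.1 := by
      rw [hjoint, ae_map_iff (hg.prodMk measurable_id').aemeasurable hs]
      exact ae_of_all _ fun _ => rfl
    exact ae_of_ae_map (hh.prodMap measurable_id).aemeasurable h3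

/-- A σ-algebra which is contained in `m'` up to null sets is conditionally independent of any other
one given `m'`. -/
lemma condIndep_of_le_eventuallyMeasurableSpace {Ω : Type*} {m' m₁ m₂ : MeasurableSpace Ω}
    {mΩ : MeasurableSpace Ω} [StandardBorelSpace Ω]
    (hm' : m' ≤ mΩ) (hm₁ : m₁ ≤ mΩ) (hm₂ : m₂ ≤ mΩ) {μ : Measure Ω} [IsFiniteMeasure μ]
    (h : m₂ ≤ eventuallyMeasurableSpace m' (ae μ)) : CondIndep m' m₁ m₂ hm' μ := by
  -- Given `m'`, the σ-algebra `m'` is independent of everything; null sets do not affect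
  -- conditional expectations.
  have hself : CondIndep m' mΩ m' hm' μ := by
    have := condIndepFun_of_measurable_right (m' := m') (hm' := hm') (μ := μ)
      (mβ := mΩ) (mβ' := m') (X := id) (Y := id) measurable_id measurable_id
    rwa [condIndepFun_iff_condIndep, MeasurableSpace.comap_id, MeasurableSpace.comap_id] at this
  rw [condIndep_iff _ _ _ hm' le_rfl hm'] at hself
  rw [condIndep_iff _ _ _ hm' hm₁ hm₂]
  intro t₁ t₂ ht₁ ht₂
  obtain ⟨s, hs, hts⟩ := h t₂ ht₂
  have h1 : μ⟦t₁ ∩ t₂ | m'⟧ =ᵐ[μ] μ⟦t₁ ∩ s | m'⟧ :=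
    condExp_congr_ae (indicator_ae_eq_of_ae_eq_set (ae_eq_set_inter (ae_eq_refl _) hts))
  have h2 : μ⟦t₂ | m'⟧ =ᵐ[μ] μ⟦s | m'⟧ := condExp_congr_ae (indicator_ae_eq_of_ae_eq_set hts)
  exact (h1.trans (hself t₁ s (hm₁ t₁ ht₁) hs)).trans ((ae_eq_refl _).mul h2.symm)

/-- The product of conditionally independent random variables has mean zero if the conditional mean
of one factor vanishes. -/
lemma integral_mul_eq_zero_of_condIndep {Ω : Type*} {m' m₁ m₂ : MeasurableSpace Ω}
    {mΩ : MeasurableSpace Ω} [StandardBorelSpace Ω]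
    {hm' : m' ≤ mΩ} (hm₁ : m₁ ≤ mΩ) (hm₂ : m₂ ≤ mΩ) {μ : Measure Ω} [IsFiniteMeasure μ]
    (h : CondIndep m' m₁ m₂ hm' μ) {f g : Ω → ℝ} (hf : Measurable[m₁] f) (hg : Measurable[m₂] g)
    (hfi : Integrable f μ) (hfg : Integrable (fun ω => f ω * g ω) μ) (h0 : μ[f | m'] =ᵐ[μ] 0) :
    ∫ ω, f ω * g ω ∂μ = 0 := by
  have hfm : Measurable f := hf.mono hm₁ le_rfl
  have hgm : Measurable g := hg.mono hm₂ le_rfl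
  have hind : CondIndepFun m' hm' f g μ := (condIndepFun_iff_condIndep _ _ _ _ _).2
    (condIndep_of_condIndep_of_le_left (condIndep_of_condIndep_of_le_right h hg.comap_le)
      hf.comap_le)
  -- Under almost every conditional law `f` and `g` are independent, so the conditional mean of `f
  -- g` factorizes. Integrability of `g` is not needed.
  rw [condIndepFun_iff_map_prod_eq_prod_map_map hfm hgm] at hind
  rw [← integral_condExp hm', ← integral_zero Ω ℝ (μ := μ)]
  refine integral_congr_ae ?_
  filter_upwards [condExp_ae_eq_integral_condExpKernel hm' hfg, ae_of_ae_trim hm' hind,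
    condExp_ae_eq_integral_condExpKernel hm' hfi, h0] with ω h1 h2 h3 h4
  rw [Kernel.map_apply _ (hfm.prodMk hgm), Kernel.prod_apply, Kernel.map_apply _ hfm,
    Kernel.map_apply _ hgm] at h2
  rw [h1]
  calc ∫ y, f y * g y ∂condExpKernel μ m' ω
      = ∫ z, z.1 * z.2 ∂(condExpKernel μ m' ω).map fun y => (f y, g y) := by
        rw [integral_map (hfm.prodMk hgm).aemeasurable (by fun_prop)]
    _ = (∫ y, f y ∂condExpKernel μ m' ω) * ∫ y, g y ∂condExpKernel μ m' ω := by
        rw [h2]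
        rw [integral_prod_mul (fun x : ℝ => x) (fun y : ℝ => y),
          integral_map hfm.aemeasurable (by fun_prop), integral_map hgm.aemeasurable (by fun_prop)]
    _ = 0 := by rw [← h3, h4]; simp

/-- Independence is inherited by the preimages of σ-algebras under a map. -/
lemma Indep.comap_of_map {Ω Ω' : Type*} {m₁ m₂ : MeasurableSpace Ω'} {mΩ : MeasurableSpace Ω}
    {mΩ' : MeasurableSpace Ω'} {μ : Measure Ω} {φ : Ω → Ω'}
    (hφ : Measurable φ) (hm₁ : m₁ ≤ mΩ') (hm₂ : m₂ ≤ mΩ') (h : Indep m₁ m₂ (μ.map φ)) :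
    Indep (m₁.comap φ) (m₂.comap φ) μ := by
  rw [Indep_iff] at h ⊢
  rintro _ _ ⟨s, hs, rfl⟩ ⟨t, ht, rfl⟩
  have := h s t hs ht
  rwa [Measure.map_apply hφ ((hm₁ s hs).inter (hm₂ t ht)), Measure.map_apply hφ (hm₁ s hs),
    Measure.map_apply hφ (hm₂ t ht), preimage_inter] at this

/-- The expected inner product of two linear combinations of square integrable functions. -/
lemma integral_inner_sum_smul {Ω K E : Type*} [MeasurableSpace Ω] [Fintype K] [NormedAddCommGroup E]
    [InnerProductSpace ℝ E] {μ : Measure Ω} {f g : K → Ω → ℝ} (hf : ∀ k, MemLp (f k) 2 μ)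
    (hg : ∀ k, MemLp (g k) 2 μ) (v w : K → E) :
    Integrable (fun ω => inner ℝ (∑ k, f k ω • v k) (∑ l, g l ω • w l)) μ ∧
      ∫ ω, inner ℝ (∑ k, f k ω • v k) (∑ l, g l ω • w l) ∂μ =
        ∑ k, ∑ l, (∫ ω, f k ω * g l ω ∂μ) * inner ℝ (v k) (w l) := by
  have hint : ∀ k l, Integrable (fun ω => f k ω * g l ω * inner ℝ (v k) (w l)) μ := fun k l =>
    ((hf k).integrable_mul (hg l)).mul_const _
  have heq : (fun ω => inner ℝ (∑ k, f k ω • v k) (∑ l, g l ω • w l)) =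
      fun ω => ∑ k, ∑ l, f k ω * g l ω * inner ℝ (v k) (w l) := by
    ext ω
    rw [sum_inner]
    refine Finset.sum_congr rfl fun k _ => ?_
    rw [inner_sum]
    refine Finset.sum_congr rfl fun l _ => ?_
    rw [inner_smul_left, inner_smul_right, conj_trivial, mul_assoc]
  rw [heq]
  refine ⟨integrable_finsetSum _ fun k _ => integrable_finsetSum _ fun l _ => hint k l, ?_⟩
  rw [integral_finsetSum _ fun k _ => integrable_finsetSum _ fun l _ => hint k l]
  refine Finset.sum_congr rfl fun k _ => ?_
  rw [integral_finsetSum _ fun l _ => hint k l]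
  exact Finset.sum_congr rfl fun l _ => integral_mul_const _ _

end Probability

/-! ### Moments of the noise and parametrization of the processes. -/

section GaussianMoments

open scoped RealInnerProductSpace

variable {Ω : Type*} [MeasurableSpace Ω] {d T : ℕ}

/-- The constant `1` and the coordinates of the Gaussian vectors `G_s`. -/
def gaussCoord {Ω : Type*} (G : Fin T → Ω → EuclideanSpace ℝ (Fin d)) :
    Option (Fin T × Fin d) → Ω → ℝ
  | none, _ => 1
  | some (s, i), ω => G s ω i

lemma memLp_coord_stdGaussian (i : Fin d) :
    MemLp (fun x : EuclideanSpace ℝ (Fin d) => x i) 2 (stdGaussian (EuclideanSpace ℝ (Fin d))) :=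
  (EuclideanSpace.proj i : EuclideanSpace ℝ (Fin d) →L[ℝ] ℝ).comp_memLp'
    (IsGaussian.memLp_id (stdGaussian (EuclideanSpace ℝ (Fin d))) 2 (by simp))

lemma integral_coord_stdGaussian (i : Fin d) :
    ∫ x, x i ∂stdGaussian (EuclideanSpace ℝ (Fin d)) = 0 :=
  integral_strongDual_stdGaussian (EuclideanSpace.proj i)

lemma integral_coord_mul_coord_stdGaussian (i j : Fin d) :
    ∫ x, x i * x j ∂stdGaussian (EuclideanSpace ℝ (Fin d)) = if i = j then 1 else 0 := by
  have h := covarianceBilin_apply (IsGaussian.memLp_id (stdGaussian (EuclideanSpace ℝ (Fin d))) 2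
    (by simp)) (EuclideanSpace.single i 1) (EuclideanSpace.single j 1)
  rw [covarianceBilin_stdGaussian] at h
  simp only [id, integral_id_stdGaussian, sub_zero, EuclideanSpace.inner_single_left, map_one,
    one_mul] at h
  rw [← h, innerSL_apply_apply ℝ]
  simp [EuclideanSpace.inner_single_left]

variable {P : Measure Ω} {G : Fin T → Ω → EuclideanSpace ℝ (Fin d)}

lemma measurable_gaussCoord (hG : ∀ t, Measurable (G t)) (k : Option (Fin T × Fin d)) :
    Measurable (gaussCoord G k) := by
  rcases k with _ | ⟨s, i⟩
  · exact measurable_const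
  · exact (EuclideanSpace.proj (𝕜 := ℝ) i).continuous.measurable.comp (hG s)

variable (hG : ∀ t, Measurable (G t))
  (hlaw : ∀ t, P.map (G t) = stdGaussian (EuclideanSpace ℝ (Fin d))) (hindep : iIndepFun G P)

include hG hlaw in
lemma memLp_gaussCoord [IsProbabilityMeasure P] (k : Option (Fin T × Fin d)) :
    MemLp (gaussCoord G k) 2 P := by
  rcases k with _ | ⟨s, i⟩
  · exact memLp_const 1
  · have h := memLp_coord_stdGaussian i
    rw [← hlaw s] at h
    exact h.comp_of_map (hG s).aemeasurable

include hG hlaw in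
lemma integral_gaussCoord_some (s : Fin T) (i : Fin d) :
    ∫ ω, gaussCoord G (some (s, i)) ω ∂P = 0 := by
  have h := integral_coord_stdGaussian i
  rw [← hlaw s, integral_map (hG s).aemeasurable (by fun_prop)] at h
  exact h

-- With the constant `1` adjoined, the noise coordinates are orthonormal in `L²(P)`, so means and
-- matrix columns can be treated alike.
include hG hlaw hindep in
lemma integral_gaussCoord_mul [IsProbabilityMeasure P] (k l : Option (Fin T × Fin d)) :
    ∫ ω, gaussCoord G k ω * gaussCoord G l ω ∂P = if k = l then 1 else 0 := by
  rcases k with _ | ⟨s, i⟩ <;> rcases l with _ | ⟨s', j⟩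
  · simp [gaussCoord]
  · simpa [gaussCoord] using integral_gaussCoord_some hG hlaw s' j
  · simpa [gaussCoord] using integral_gaussCoord_some hG hlaw s i
  · by_cases hs : s = s'
    · subst hs
      have h := integral_coord_mul_coord_stdGaussian i j
      rw [← hlaw s, integral_map (hG s).aemeasurable (by fun_prop)] at h
      simpa [gaussCoord] using h
    · have h := ((hindep.indepFun hs).comp (φ := fun x : EuclideanSpace ℝ (Fin d) => x i)
        (ψ := fun x : EuclideanSpace ℝ (Fin d) => x j) (by fun_prop)
        (by fun_prop)).integral_fun_mul_eq_mul_integral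
        (measurable_gaussCoord hG (some (s, i))).aestronglyMeasurable
        (measurable_gaussCoord hG (some (s', j))).aestronglyMeasurable
      have h0 := integral_gaussCoord_some hG hlaw s i
      simp only [gaussCoord, Function.comp_apply] at h h0 ⊢
      rw [h, h0]
      simp [hs]

/-- The Gaussian process with a given parameter. -/
noncomputable def gaussianPath {Ω : Type*} (G : Fin T → Ω → EuclideanSpace ℝ (Fin d))
    (v : gaussianParams d T) :
    Fin T → Ω → EuclideanSpace ℝ (Fin d) :=
  fun t ω => ∑ k, gaussCoord G k ω • v.1 (t, k)

lemma affineProcess_apply {Ω : Type*} (G : Fin T → Ω → EuclideanSpace ℝ (Fin d))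
    (a : Fin T → EuclideanSpace ℝ (Fin d))
    (L : Matrix (Fin T) (Fin T) (Matrix (Fin d) (Fin d) ℝ)) (t : Fin T) (ω : Ω) :
    affineProcess G a L t ω =
      a t + ∑ s, ∑ i, G s ω i • (WithLp.toLp 2 fun j => L t s j i : EuclideanSpace ℝ (Fin d)) := by
  rw [affineProcess]
  congr 1
  refine Finset.sum_congr rfl fun s _ => ?_
  ext j
  simp [Matrix.toLpLin_apply, Matrix.mulVec, dotProduct, mul_comm]

lemma gaussianPath_apply {Ω : Type*} (G : Fin T → Ω → EuclideanSpace ℝ (Fin d))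
    (v : gaussianParams d T) (t : Fin T) (ω : Ω) :
    gaussianPath G v t ω = v.1 (t, none) + ∑ s, ∑ i, G s ω i • v.1 (t, some (s, i)) := by
  simp [gaussianPath, gaussCoord, Fintype.sum_option, Fintype.sum_prod_type]

lemma gaussianPath_mem {Ω : Type*} (G : Fin T → Ω → EuclideanSpace ℝ (Fin d))
    (v : gaussianParams d T) : gaussianPath G v ∈ gaussianProcesses G := by
  refine ⟨fun t => v.1 (t, none), Matrix.of fun t s => Matrix.of fun j i => v.1 (t, some (s, i)) j,
    fun t s hts => ?_, ?_⟩
  · ext j i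
    simp [v.2 t s i hts]
  · ext t ω : 2
    rw [affineProcess_apply, gaussianPath_apply]
    rfl

lemma exists_gaussianPath_eq {Ω : Type*} {G X : Fin T → Ω → EuclideanSpace ℝ (Fin d)}
    (hX : X ∈ gaussianProcesses G) : ∃ v : gaussianParams d T, gaussianPath G v = X := by
  obtain ⟨a, L, hL, rfl⟩ := hX
  refine ⟨⟨WithLp.toLp 2 fun k => k.2.elim (a k.1)
    fun l => WithLp.toLp 2 fun j => L k.1 l.1 j l.2, fun t s i hts => ?_⟩, ?_⟩
  · ext j
    simp [hL t s hts]
  · ext t ω : 2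
    rw [affineProcess_apply, gaussianPath_apply]
    rfl

end GaussianMoments

/-! ### The transport cost of a coupling. -/

section Cost

open scoped RealInnerProductSpace

variable {Ω : Type*} [MeasurableSpace Ω] {d T : ℕ} {P : Measure Ω}
  {G : Fin T → Ω → EuclideanSpace ℝ (Fin d)} (hG : ∀ t, Measurable (G t))
  (hlaw : ∀ t, P.map (G t) = stdGaussian (EuclideanSpace ℝ (Fin d))) (hindep : iIndepFun G P)

variable {Ω' : Type*} [MeasurableSpace Ω'] {π : Measure Ω'} {φ ψ : Ω' → Ω}

include hG hlaw in
lemma memLp_gaussCoord_comp [IsProbabilityMeasure P] (hφ : Measurable φ) (hφP : π.map φ = P)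
    (k : Option (Fin T × Fin d)) : MemLp (fun p => gaussCoord G k (φ p)) 2 π := by
  have h := memLp_gaussCoord hG hlaw k
  rw [← hφP] at h
  exact h.comp_of_map hφ.aemeasurable

include hG hlaw hindep in
lemma integral_gaussCoord_comp_mul [IsProbabilityMeasure P] (hφ : Measurable φ) (hφP : π.map φ = P)
    (k l : Option (Fin T × Fin d)) :
    ∫ p, gaussCoord G k (φ p) * gaussCoord G l (φ p) ∂π = if k = l then 1 else 0 := by
  have h := integral_gaussCoord_mul hG hlaw hindep k l
  rwa [← hφP, integral_map (f := fun ω => gaussCoord G k ω * gaussCoord G l ω) hφ.aemeasurable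
    ((measurable_gaussCoord hG k).mul (measurable_gaussCoord hG l)).aestronglyMeasurable] at h

include hG hlaw in
lemma integral_gaussCoord_comp_some (hφ : Measurable φ) (hφP : π.map φ = P)
    (s : Fin T) (i : Fin d) : ∫ p, gaussCoord G (some (s, i)) (φ p) ∂π = 0 := by
  have h := integral_gaussCoord_some hG hlaw s i
  rwa [← hφP, integral_map hφ.aemeasurable
    (measurable_gaussCoord hG _).aestronglyMeasurable] at h

include hG hlaw hindep in
/-- The block-diagonal covariances of two standard Gaussian vectors are contractions. -/
lemma covariance_contraction [IsProbabilityMeasure P] (hφ : Measurable φ) (hφP : π.map φ = P)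
    (hψ : Measurable ψ) (hψP : π.map ψ = P) (s : Fin T) (x y : EuclideanSpace ℝ (Fin d)) :
    ∑ i, ∑ j, x i * y j *
      ∫ p, gaussCoord G (some (s, i)) (φ p) * gaussCoord G (some (s, j)) (ψ p) ∂π ≤
      (‖x‖ ^ 2 + ‖y‖ ^ 2) / 2 := by
  have hφ2 := fun i => memLp_gaussCoord_comp hG hlaw hφ hφP (some (s, i))
  have hψ2 := fun i => memLp_gaussCoord_comp hG hlaw hψ hψP (some (s, i))
  -- Integrate `U V ≤ (U² + V²) / 2` for the scalar combinations `U`, `V` of the noises with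
  -- coefficients `x`, `y`; their second moments are `‖x‖²` and `‖y‖²`.
  obtain ⟨hi, h⟩ := integral_inner_sum_smul hφ2 hψ2 x y
  obtain ⟨hi1, h1⟩ := integral_inner_sum_smul hφ2 hφ2 x x
  obtain ⟨hi2, h2⟩ := integral_inner_sum_smul hψ2 hψ2 y y
  simp only [integral_gaussCoord_comp_mul hG hlaw hindep hφ hφP,
    integral_gaussCoord_comp_mul hG hlaw hindep hψ hψP, Option.some_inj, Prod.mk.injEq, true_and,
    ite_mul, one_mul, zero_mul, Finset.sum_ite_eq, Finset.mem_univ, if_true] at h1 h2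
  have hn : ∀ z : EuclideanSpace ℝ (Fin d), ‖z‖ ^ 2 = ∑ i, ⟪z i, z i⟫ := fun z => by
    rw [← real_inner_self_eq_norm_sq, PiLp.inner_apply]
  rw [hn, hn, ← h1, ← h2, ← integral_add hi1 hi2, ← integral_div]
  calc _ = ∑ i, ∑ j,
        (∫ p, gaussCoord G (some (s, i)) (φ p) * gaussCoord G (some (s, j)) (ψ p) ∂π) *
          ⟪x i, y j⟫ := by
        refine Finset.sum_congr rfl fun i _ => Finset.sum_congr rfl fun j _ => ?_
        rw [mul_comm, real_inner_comm]
        rfl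
    _ ≤ _ := by
        rw [← h]
        refine integral_mono hi ((hi1.add hi2).div_const 2) fun p => ?_
        have := real_inner_le_norm (∑ k, gaussCoord G (some (s, k)) (φ p) • x k)
          (∑ l, gaussCoord G (some (s, l)) (ψ p) • y l)
        simp only [real_inner_self_eq_norm_sq]
        nlinarith [sq_nonneg (‖∑ k, gaussCoord G (some (s, k)) (φ p) • x k‖ -
          ‖∑ l, gaussCoord G (some (s, l)) (ψ p) • y l‖)]

include hG hlaw hindep in
/-- The expected squared distance of two Gaussian processes under a coupling of the driving noises
with block-diagonal covariance. -/
lemma lintegral_gaussianPath_sub [IsProbabilityMeasure P] (hφ : Measurable φ) (hφP : π.map φ = P)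
    (hψ : Measurable ψ) (hψP : π.map ψ = P) (C : Fin T → Matrix (Fin d) (Fin d) ℝ)
    (hC : ∀ s s' i j, ∫ p, gaussCoord G (some (s, i)) (φ p) * gaussCoord G (some (s', j)) (ψ p) ∂π =
      if s = s' then C s i j else 0) (v w : gaussianParams d T) :
    ∫⁻ p, ∑ t, ‖gaussianPath G v t (φ p) - gaussianPath G w t (ψ p)‖ₑ ^ 2 ∂π =
      ENNReal.ofReal (‖v‖ ^ 2 + ‖w‖ ^ 2 - 2 * ⟪v, rotate C w⟫) := by
  have hπ : IsProbabilityMeasure π := by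
    constructor
    rw [← preimage_univ (f := φ), ← Measure.map_apply hφ MeasurableSet.univ, hφP, measure_univ]
  have hφ2 := memLp_gaussCoord_comp hG hlaw hφ hφP
  have hψ2 := memLp_gaussCoord_comp hG hlaw hψ hψP
  have hvv := fun t => integral_inner_sum_smul hφ2 hφ2 (fun k => v.1 (t, k)) fun k => v.1 (t, k)
  have hww := fun t => integral_inner_sum_smul hψ2 hψ2 (fun k => w.1 (t, k)) fun k => w.1 (t, k)
  have hvw := fun t => integral_inner_sum_smul hφ2 hψ2 (fun k => v.1 (t, k)) fun k => w.1 (t, k)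
  have hexp : ∀ p, ∑ t, ‖gaussianPath G v t (φ p) - gaussianPath G w t (ψ p)‖ ^ 2 =
      ∑ t, (⟪gaussianPath G v t (φ p), gaussianPath G v t (φ p)⟫ +
        ⟪gaussianPath G w t (ψ p), gaussianPath G w t (ψ p)⟫ -
        2 * ⟪gaussianPath G v t (φ p), gaussianPath G w t (ψ p)⟫) := fun p => by
    refine Finset.sum_congr rfl fun t _ => ?_
    rw [norm_sub_sq_real, real_inner_self_eq_norm_sq, real_inner_self_eq_norm_sq]
    ring
  have hint : ∀ t, Integrable (fun p => ⟪gaussianPath G v t (φ p), gaussianPath G v t (φ p)⟫ +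
        ⟪gaussianPath G w t (ψ p), gaussianPath G w t (ψ p)⟫ -
        2 * ⟪gaussianPath G v t (φ p), gaussianPath G w t (ψ p)⟫) π := fun t =>
    ((hvv t).1.add (hww t).1).sub ((hvw t).1.const_mul 2)
  have hnorm : ∀ u : gaussianParams d T, ‖u‖ ^ 2 = ∑ t, ∑ k, ⟪u.1 (t, k), u.1 (t, k)⟫ := fun u => by
    rw [← real_inner_self_eq_norm_sq, inner_gaussianParams]
    simp only [Fintype.sum_option, Fintype.sum_prod_type]
  have hcross : ⟪v, rotate C w⟫ = ∑ t, ∑ k, ∑ l,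
      (∫ p, gaussCoord G k (φ p) * gaussCoord G l (ψ p) ∂π) * ⟪v.1 (t, k), w.1 (t, l)⟫ := by
    -- Both noises are centred, so means do not interact with matrix columns.
    have h0 : ∀ s i, ∫ p, gaussCoord G none (φ p) * gaussCoord G (some (s, i)) (ψ p) ∂π = 0 :=
      fun s i => by
        simpa [gaussCoord] using integral_gaussCoord_comp_some hG hlaw hψ hψP s i
    have h1 : ∀ s i, ∫ p, gaussCoord G (some (s, i)) (φ p) * gaussCoord G none (ψ p) ∂π = 0 :=
      fun s i => by
        simpa [gaussCoord] using integral_gaussCoord_comp_some hG hlaw hφ hφP s i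
    have h2 : ∫ p, gaussCoord G none (φ p) * gaussCoord G none (ψ p) ∂π = 1 := by
      simp [gaussCoord]
    rw [inner_rotate]
    refine Finset.sum_congr rfl fun t _ => ?_
    simp only [Fintype.sum_option, Fintype.sum_prod_type, h0, h1, h2, hC, ite_mul, zero_mul,
      one_mul, Finset.sum_const_zero, add_zero, zero_add]
    congr 1
    refine Finset.sum_congr rfl fun s _ => Finset.sum_congr rfl fun i _ => ?_
    rw [Finset.sum_comm]
    simp
  calc _ = ∫⁻ p, ENNReal.ofReal
        (∑ t, ‖gaussianPath G v t (φ p) - gaussianPath G w t (ψ p)‖ ^ 2) ∂π := by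
        refine lintegral_congr fun p => ?_
        rw [ENNReal.ofReal_sum_of_nonneg fun t _ => sq_nonneg _]
        refine Finset.sum_congr rfl fun t _ => ?_
        rw [ENNReal.ofReal_pow (norm_nonneg _), ofReal_norm]
    _ = ENNReal.ofReal (∫ p, ∑ t,
        ‖gaussianPath G v t (φ p) - gaussianPath G w t (ψ p)‖ ^ 2 ∂π) := by
        refine (ofReal_integral_eq_lintegral_ofReal ?_ (ae_of_all _ fun p => ?_)).symm
        · simp only [hexp]
          exact integrable_finsetSum _ fun t _ => hint t
        · exact Finset.sum_nonneg fun t _ => sq_nonneg _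
    _ = _ := by
        congr 1
        simp only [hexp]
        rw [integral_finsetSum _ fun t _ => hint t, hnorm, hnorm, hcross, Finset.mul_sum,
          ← Finset.sum_add_distrib, ← Finset.sum_sub_distrib]
        refine Finset.sum_congr rfl fun t _ => ?_
        simp only [gaussianPath]
        have hsub := integral_sub ((hvv t).1.add (hww t).1) ((hvw t).1.const_mul 2)
        simp only [Pi.add_apply] at hsub
        rw [hsub, integral_add (hvv t).1 (hww t).1, integral_const_mul, (hvv t).2, (hww t).2,
          (hvw t).2]
        simp [integral_gaussCoord_comp_mul hG hlaw hindep hφ hφP,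
          integral_gaussCoord_comp_mul hG hlaw hindep hψ hψP]

end Cost

/-! ### Consequences of causality for the noises. -/

section Bicausal

open scoped RealInnerProductSpace

variable {Ω : Type*} [MeasurableSpace Ω] {d T : ℕ} {P : Measure Ω}
  {G : Fin T → Ω → EuclideanSpace ℝ (Fin d)} (hG : ∀ t, Measurable (G t))

lemma measurable_generatedFiltration {s t : Fin T} (hst : s ≤ t) :
    Measurable[generatedFiltration G hG t] (G s) :=
  measurable_iff_comap_le.2
    (le_iSup₂ (f := fun (j : Fin T) (_ : j ≤ t) => MeasurableSpace.comap (G j) inferInstance) s hst)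

lemma indep_comap_generatedFiltration (hindep : iIndepFun G P) {s t : Fin T} (hst : s < t) :
    Indep (MeasurableSpace.comap (G t) inferInstance) (generatedFiltration G hG s) P := by
  have h := indep_iSup_of_disjoint (m := fun j => MeasurableSpace.comap (G j) inferInstance)
    (fun j => (hG j).comap_le) hindep (S := {t}) (T := Iic s) (by simpa using hst)
  rwa [iSup_singleton] at h

variable {Ω' : Type*} {mΩ' : MeasurableSpace Ω'} [StandardBorelSpace Ω'] {π : Measure Ω'}
  {φ ψ : Ω' → Ω}

/-- Under a causal coupling, the future of one noise is uncorrelated with the past of the other. -/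
lemma integral_gaussCoord_mul_eq_zero_of_causal [NeZero T] [IsProbabilityMeasure P]
    [IsFiniteMeasure π] (hlaw : ∀ t, P.map (G t) = stdGaussian (EuclideanSpace ℝ (Fin d)))
    (hindep : iIndepFun G P)
    (hφ : Measurable φ) (hφP : π.map φ = P) (hψ : Measurable ψ) (hψP : π.map ψ = P)
    {s t : Fin T} (hst : s < t) {hle : (generatedFiltration G hG s).comap φ ≤ mΩ'}
    (h : CondIndep ((generatedFiltration G hG s).comap φ) ((generatedFiltration G hG ⊤).comap φ)
      ((generatedFiltration G hG s).comap ψ) hle π) (i j : Fin d) :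
    ∫ p, gaussCoord G (some (t, j)) (φ p) * gaussCoord G (some (s, i)) (ψ p) ∂π = 0 := by
  have hcoord : ∀ k : Fin d, Measurable fun x : EuclideanSpace ℝ (Fin d) => x k := by fun_prop
  have hle' : ∀ (u : Fin T) {χ : Ω' → Ω}, Measurable χ →
      (generatedFiltration G hG u).comap χ ≤ mΩ' := fun u χ hχ =>
    (MeasurableSpace.comap_mono ((generatedFiltration G hG).le u)).trans hχ.comap_le
  have hφ2 := memLp_gaussCoord_comp hG hlaw hφ hφP (some (t, j))
  have hψ2 := memLp_gaussCoord_comp hG hlaw hψ hψP (some (s, i))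
  refine integral_mul_eq_zero_of_condIndep (hle' ⊤ hφ) (hle' s hψ) h
    (((hcoord j).comp (measurable_generatedFiltration hG le_top)).comp (comap_measurable φ))
    (((hcoord i).comp (measurable_generatedFiltration hG le_rfl)).comp (comap_measurable ψ))
    (hφ2.integrable one_le_two) (hφ2.integrable_mul hψ2) ?_
  -- The later noise `G t ∘ φ` is independent of the past of `φ`, so its conditional mean given that
  -- past is its mean, zero.
  have hind : Indep ((MeasurableSpace.comap (G t) inferInstance).comap φ)
      ((generatedFiltration G hG s).comap φ) π :=
    Indep.comap_of_map hφ (hG t).comap_le ((generatedFiltration G hG).le s)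
      (by rw [hφP]; exact indep_comap_generatedFiltration hG hindep hst)
  refine (condExp_indep_eq
    ((MeasurableSpace.comap_mono (hG t).comap_le).trans hφ.comap_le) hle ?_ hind).trans ?_
  · exact (((hcoord j).comp (comap_measurable (G t))).comp (comap_measurable φ)).stronglyMeasurable
  · rw [integral_gaussCoord_comp_some hG hlaw hφ hφP t j]
    rfl

omit [StandardBorelSpace Ω'] in
/-- If one noise is a function of the other at each time, so are the generated filtrations, up to
null sets. -/
lemma comap_generatedFiltration_le_eventuallyMeasurableSpace
    {A : Fin T → EuclideanSpace ℝ (Fin d) → EuclideanSpace ℝ (Fin d)} (hA : ∀ s, Measurable (A s))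
    (h : ∀ s, ∀ᵐ p ∂π, G s (ψ p) = A s (G s (φ p))) (t : Fin T) :
    (generatedFiltration G hG t).comap ψ ≤
      eventuallyMeasurableSpace ((generatedFiltration G hG t).comap φ) (ae π) := by
  change MeasurableSpace.comap ψ (⨆ s, ⨆ (_ : s ≤ t), MeasurableSpace.comap (G s) inferInstance) ≤ _
  simp only [MeasurableSpace.comap_iSup, MeasurableSpace.comap_comp]
  refine iSup₂_le fun s hs => ?_
  have hm : Measurable[(generatedFiltration G hG t).comap φ] (A s ∘ G s ∘ φ) :=
    (hA s).comp ((measurable_generatedFiltration hG hs).comp (comap_measurable φ))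
  exact (hm.eventuallyMeasurable_of_eventuallyEq (h s)).comap_le

end Bicausal

/-! ### Rotational couplings and the distance formula. -/

section Rotation

open scoped RealInnerProductSpace

variable {d T : ℕ}

lemma toEuclideanLin_transpose_toEuclideanLin {O : Matrix (Fin d) (Fin d) ℝ}
    (hO : O ∈ Matrix.orthogonalGroup (Fin d) ℝ) (x : EuclideanSpace ℝ (Fin d)) :
    Matrix.toEuclideanLin O (Matrix.toEuclideanLin O.transpose x) = x := by
  have h : O * O.transpose = 1 := (Matrix.mem_orthogonalGroup_iff _ _).1 hO
  simp [Matrix.toLpLin_apply, Matrix.mulVec_mulVec, h]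

/-- `Oᵀ` is a linear isometry, because its adjoint `O` inverts it, and standard Gaussians are
invariant under linear isometries. -/
lemma stdGaussian_map_toEuclideanLin_transpose {O : Matrix (Fin d) (Fin d) ℝ}
    (hO : O ∈ Matrix.orthogonalGroup (Fin d) ℝ) :
    (stdGaussian (EuclideanSpace ℝ (Fin d))).map (Matrix.toEuclideanLin O.transpose) =
      stdGaussian (EuclideanSpace ℝ (Fin d)) := by
  have hadj : Matrix.toEuclideanLin O = (Matrix.toEuclideanLin O.transpose).adjoint := by
    rw [← Matrix.toEuclideanLin_conjTranspose_eq_adjoint]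
    simp
  have hnorm : ∀ x, ‖Matrix.toEuclideanLin O.transpose x‖ = ‖x‖ := fun x => by
    rw [← sq_eq_sq₀ (norm_nonneg _) (norm_nonneg _), ← real_inner_self_eq_norm_sq,
      ← LinearMap.adjoint_inner_right, ← hadj, toEuclideanLin_transpose_toEuclideanLin hO,
      real_inner_self_eq_norm_sq]
  exact stdGaussian_map
    (LinearIsometry.toLinearIsometryEquiv ⟨Matrix.toEuclideanLin O.transpose, hnorm⟩ rfl)

variable {Ω : Type*} [MeasurableSpace Ω] [StandardBorelSpace Ω] {P : Measure Ω}
  [IsProbabilityMeasure P] {G : Fin T → Ω → EuclideanSpace ℝ (Fin d)}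

/-- Block-diagonal orthogonal matrices are the covariances of bicausal couplings. -/
lemma exists_bicausal_rotation [NeZero T] (hG : ∀ t, Measurable (G t))
    (hlaw : ∀ t, P.map (G t) = stdGaussian (EuclideanSpace ℝ (Fin d))) (hindep : iIndepFun G P)
    {O : Fin T → Matrix (Fin d) (Fin d) ℝ}
    (hO : ∀ s, O s ∈ Matrix.orthogonalGroup (Fin d) ℝ) :
    ∃ π : ProbabilityMeasure (Ω × Ω),
      IsBicausalCoupling P (generatedFiltration G hG) P (generatedFiltration G hG)
        (π : Measure (Ω × Ω)) ∧
      ∀ s s' i j, ∫ p, gaussCoord G (some (s, i)) p.1 * gaussCoord G (some (s', j)) p.2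
        ∂(π : Measure (Ω × Ω)) = if s = s' then O s i j else 0 := by
  have hA : ∀ B : Matrix (Fin d) (Fin d) ℝ, Measurable (Matrix.toEuclideanLin B) := fun B =>
    (LinearMap.continuous_of_finiteDimensional _).measurable
  have hmap : P.map (fun ω s => G s ω) =
      P.map fun ω s => Matrix.toEuclideanLin (O s).transpose (G s ω) := by
    rw [(iIndepFun_iff_map_fun_eq_pi_map fun s => (hG s).aemeasurable).1 hindep]
    have h := hindep.comp (fun s => Matrix.toEuclideanLin (O s).transpose) fun s => hA _
    rw [iIndepFun_iff_map_fun_eq_pi_map fun s => ((hA _).comp (hG s)).aemeasurable] at h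
    refine Eq.trans ?_ h.symm
    congr 1
    ext1 s
    rw [← Measure.map_map (hA _) (hG s), hlaw, stdGaussian_map_toEuclideanLin_transpose (hO s)]
  -- `Ω` may carry more randomness than `G`, so only the noise of the second coordinate is
  -- prescribed. As `Oᵀ` is invertible blockwise, the two pasts agree up to null sets at each time,
  -- which gives both causality conditions.
  obtain ⟨π, hfst, hsnd, hae⟩ := exists_coupling_of_map_eq P (measurable_pi_lambda _ hG)
    (measurable_pi_lambda _ fun s => (hA (O s).transpose).comp (hG s)) hmap
  have h1 : ∀ s, ∀ᵐ p ∂(π : Measure (Ω × Ω)),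
      G s p.2 = Matrix.toEuclideanLin (O s).transpose (G s p.1) := fun s => by
    filter_upwards [hae] with p hp using congrFun hp s
  have h2 : ∀ s, ∀ᵐ p ∂(π : Measure (Ω × Ω)), G s p.1 = Matrix.toEuclideanLin (O s) (G s p.2) :=
    fun s => by
      filter_upwards [h1 s] with p hp
      rw [hp, toEuclideanLin_transpose_toEuclideanLin (hO s)]
  have hle : ∀ (u : Fin T) {χ : Ω × Ω → Ω}, Measurable χ →
      (generatedFiltration G hG u).comap χ ≤ (inferInstance : MeasurableSpace (Ω × Ω)) := fun u χ hχ =>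
    (MeasurableSpace.comap_mono ((generatedFiltration G hG).le u)).trans hχ.comap_le
  refine ⟨π, ⟨hfst, hsnd, fun t => ?_, fun t => ?_⟩, fun s s' i j => ?_⟩
  · exact condIndep_of_le_eventuallyMeasurableSpace (hle t measurable_fst) (hle ⊤ measurable_fst)
      (hle t measurable_snd) (comap_generatedFiltration_le_eventuallyMeasurableSpace hG
        (fun s => hA _) h1 t)
  · exact condIndep_of_le_eventuallyMeasurableSpace (hle t measurable_snd) (hle ⊤ measurable_snd)
      (hle t measurable_fst) (comap_generatedFiltration_le_eventuallyMeasurableSpace hG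
        (fun s => hA _) h2 t)
  · have heq : (fun p : Ω × Ω => gaussCoord G (some (s, i)) p.1 * gaussCoord G (some (s', j)) p.2)
        =ᵐ[(π : Measure (Ω × Ω))] fun p => ∑ k, O s' k j *
          (gaussCoord G (some (s, i)) p.1 * gaussCoord G (some (s', k)) p.1) := by
      filter_upwards [h1 s'] with p hp
      have hj : gaussCoord G (some (s', j)) p.2 =
          ∑ k, O s' k j * gaussCoord G (some (s', k)) p.1 := by
        simp only [gaussCoord, hp]
        simp [Matrix.toLpLin_apply, Matrix.mulVec, dotProduct]
      rw [hj, Finset.mul_sum]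
      exact Finset.sum_congr rfl fun k _ => mul_left_comm _ _ _
    have hL2 := memLp_gaussCoord_comp hG hlaw measurable_fst hfst
    have hint : ∀ k, Integrable (fun p : Ω × Ω => O s' k j *
        (gaussCoord G (some (s, i)) p.1 * gaussCoord G (some (s', k)) p.1))
        (π : Measure (Ω × Ω)) := fun k =>
      ((hL2 (some (s, i))).integrable_mul (hL2 (some (s', k)))).const_mul _
    rw [integral_congr_ae heq, integral_finsetSum _ fun k _ => hint k]
    simp only [integral_const_mul,
      integral_gaussCoord_comp_mul hG hlaw hindep measurable_fst hfst]
    by_cases hs : s = s'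
    · subst hs
      simp
    · simp [hs]

/-- The adapted Wasserstein distance of two Gaussian processes is the minimal distance of their
parameters up to block-diagonal rotations. -/
theorem gaussianAW_gaussianPath [NeZero T] (hG : ∀ t, Measurable (G t))
    (hlaw : ∀ t, P.map (G t) = stdGaussian (EuclideanSpace ℝ (Fin d))) (hindep : iIndepFun G P)
    (v w : gaussianParams d T) :
    (∃ O : Fin T → Matrix (Fin d) (Fin d) ℝ, (∀ s, O s ∈ Matrix.orthogonalGroup (Fin d) ℝ) ∧
      gaussianAW P G hG (gaussianPath G v) (gaussianPath G w) =
        ENNReal.ofReal ‖v - rotate O w‖) ∧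
    ∀ O : Fin T → Matrix (Fin d) (Fin d) ℝ, (∀ s, O s ∈ Matrix.orthogonalGroup (Fin d) ℝ) →
      gaussianAW P G hG (gaussianPath G v) (gaussianPath G w) ≤
        ENNReal.ofReal ‖v - rotate O w‖ := by
  have hsq : ∀ O : Fin T → Matrix (Fin d) (Fin d) ℝ,
      (∀ s, O s ∈ Matrix.orthogonalGroup (Fin d) ℝ) →
      ‖v‖ ^ 2 + ‖w‖ ^ 2 - 2 * ⟪v, rotate O w⟫ = ‖v - rotate O w‖ ^ 2 := fun O hO => by
    rw [norm_sub_sq_real, norm_rotate hO]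
    ring
  have hroot : ∀ r : ℝ, 0 ≤ r → ENNReal.ofReal (r ^ 2) ^ (1 / 2 : ℝ) = ENNReal.ofReal r :=
    fun r hr => by
      rw [ENNReal.ofReal_rpow_of_nonneg (sq_nonneg r) (by norm_num), ← Real.sqrt_eq_rpow,
        Real.sqrt_sq hr]
  have hupper : ∀ O : Fin T → Matrix (Fin d) (Fin d) ℝ,
      (∀ s, O s ∈ Matrix.orthogonalGroup (Fin d) ℝ) →
      gaussianAW P G hG (gaussianPath G v) (gaussianPath G w) ≤
        ENNReal.ofReal ‖v - rotate O w‖ := fun O hO => by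
    obtain ⟨π, hπ, hcov⟩ := exists_bicausal_rotation hG hlaw hindep hO
    rw [← hroot _ (norm_nonneg _), ← hsq O hO, ← lintegral_gaussianPath_sub hG hlaw hindep
      measurable_fst hπ.map_fst measurable_snd hπ.map_snd O hcov]
    exact ENNReal.rpow_le_rpow (iInf₂_le π hπ) (by norm_num)
  obtain ⟨O, hO, hmax⟩ := exists_optimal_rotation v w
  refine ⟨⟨O, hO, (hupper O hO).antisymm ?_⟩, hupper⟩
  rw [← hroot _ (norm_nonneg _), ← hsq O hO]
  refine ENNReal.rpow_le_rpow (le_iInf₂ fun π hπ => ?_) (by norm_num)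
  let C : Fin T → Matrix (Fin d) (Fin d) ℝ := fun s => Matrix.of fun i j =>
    ∫ p, gaussCoord G (some (s, i)) p.1 * gaussCoord G (some (s, j)) p.2 ∂(π : Measure (Ω × Ω))
  have hC : ∀ s s' i j, ∫ p, gaussCoord G (some (s, i)) p.1 * gaussCoord G (some (s', j)) p.2
      ∂(π : Measure (Ω × Ω)) = if s = s' then C s i j else 0 := fun s s' i j => by
    -- Above the diagonal the later noise belongs to the second coordinate and anticausality
    -- applies; below it, causality does.
    rcases lt_trichotomy s s' with h | rfl | h
    · rw [if_neg h.ne]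
      simp only [mul_comm (gaussCoord G (some (s, i)) _)]
      exact integral_gaussCoord_mul_eq_zero_of_causal hG hlaw hindep measurable_snd hπ.map_snd
        measurable_fst hπ.map_fst h (hπ.anticausal s) i j
    · rw [if_pos rfl]
      rfl
    · rw [if_neg h.ne']
      exact integral_gaussCoord_mul_eq_zero_of_causal hG hlaw hindep measurable_fst hπ.map_fst
        measurable_snd hπ.map_snd h (hπ.causal s') j i
  rw [lintegral_gaussianPath_sub hG hlaw hindep measurable_fst hπ.map_fst measurable_snd
    hπ.map_snd C hC]
  refine ENNReal.ofReal_le_ofReal ?_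
  linarith [hmax C fun s x y => covariance_contraction hG hlaw hindep measurable_fst hπ.map_fst
    measurable_snd hπ.map_snd s x y]

end Rotation

/-! ### The quotient metric and the conclusion. -/

section Metric

/-- The quotient of a pseudometric space by the relation of having distance zero is a metric
space. -/
lemma exists_metricSpace_quot {α : Type*} [PseudoMetricSpace α] {r : α → α → Prop}
    (hr : ∀ x y, r x y ↔ edist x y = 0) :
    ∃ _ : MetricSpace (Quot r), ∀ x y, edist (Quot.mk r x) (Quot.mk r y) = edist x y := by
  have hinsep : ∀ x y, r x y ↔ SeparationQuotient.mk x = SeparationQuotient.mk y := fun x y => by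
    rw [SeparationQuotient.mk_eq_mk, EMetric.inseparable_iff, hr]
  -- `Quot` identifies along the equivalence generated by `r`; injectivity of this map shows that
  -- nothing beyond `r` is identified.
  let f : Quot r → SeparationQuotient α :=
    Quot.lift SeparationQuotient.mk fun x y h => (hinsep x y).1 h
  have hf : Function.Injective f := by
    rintro ⟨x⟩ ⟨y⟩ h
    exact Quot.sound ((hinsep x y).2 h)
  exact ⟨MetricSpace.induced f hf inferInstance, fun x y => SeparationQuotient.edist_mk x y⟩

variable {d T : ℕ} [NeZero T] {Ω : Type*} [MeasurableSpace Ω] [StandardBorelSpace Ω]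
  {P : Measure Ω} [IsProbabilityMeasure P] {G : Fin T → Ω → EuclideanSpace ℝ (Fin d)}
  (hG : ∀ t, Measurable (G t))
  (hlaw : ∀ t, P.map (G t) = stdGaussian (EuclideanSpace ℝ (Fin d))) (hindep : iIndepFun G P)

include hlaw hindep

lemma gaussianAW_rotate_self {O : Fin T → Matrix (Fin d) (Fin d) ℝ}
    (hO : ∀ s, O s ∈ Matrix.orthogonalGroup (Fin d) ℝ) (v : gaussianParams d T) :
    gaussianAW P G hG (gaussianPath G (rotate O v)) (gaussianPath G v) = 0 := by
  have h := (gaussianAW_gaussianPath hG hlaw hindep (rotate O v) v).2 O hO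
  rwa [sub_self, norm_zero, ENNReal.ofReal_zero, nonpos_iff_eq_zero] at h

lemma gaussianAW_gaussianPath_le (v w : gaussianParams d T) :
    gaussianAW P G hG (gaussianPath G v) (gaussianPath G w) ≤ ENNReal.ofReal ‖v - w‖ := by
  have h := (gaussianAW_gaussianPath hG hlaw hindep v w).2 1 fun s => one_mem _
  rwa [rotate_one] at h

/-- An optimal rotation in one direction yields its transpose as a competitor in the other. -/
lemma gaussianAW_gaussianPath_comm_le (v w : gaussianParams d T) :
    gaussianAW P G hG (gaussianPath G v) (gaussianPath G w) ≤
      gaussianAW P G hG (gaussianPath G w) (gaussianPath G v) := by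
  obtain ⟨⟨O, hO, h⟩, -⟩ := gaussianAW_gaussianPath hG hlaw hindep w v
  have hO' : ∀ s, star O s ∈ Matrix.orthogonalGroup (Fin d) ℝ := fun s => Unitary.star_mem (hO s)
  have hstar : star O * O = 1 := funext fun s => (Matrix.mem_orthogonalGroup_iff' _ _).1 (hO s)
  have hnorm : ‖v - rotate (star O) w‖ = ‖w - rotate O v‖ := by
    rw [norm_sub_rev w, ← norm_rotate hO' (rotate O v - w), rotate_sub, ← rotate_mul, hstar,
      rotate_one]
  rw [h, ← hnorm]
  exact (gaussianAW_gaussianPath hG hlaw hindep v w).2 _ hO'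

/-- The product of the two optimal rotations is a competitor for the outer pair, and rotations
preserve the norm. -/
lemma gaussianAW_gaussianPath_triangle (u v w : gaussianParams d T) :
    gaussianAW P G hG (gaussianPath G u) (gaussianPath G w) ≤
      gaussianAW P G hG (gaussianPath G u) (gaussianPath G v) +
        gaussianAW P G hG (gaussianPath G v) (gaussianPath G w) := by
  obtain ⟨⟨O, hO, h⟩, -⟩ := gaussianAW_gaussianPath hG hlaw hindep u v
  obtain ⟨⟨O', hO', h'⟩, -⟩ := gaussianAW_gaussianPath hG hlaw hindep v w
  rw [h, h', ← ENNReal.ofReal_add (norm_nonneg _) (norm_nonneg _), ← norm_rotate hO (v - _),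
    rotate_sub, ← rotate_mul]
  exact ((gaussianAW_gaussianPath hG hlaw hindep u w).2 (O * O') fun s =>
    mul_mem (hO s) (hO' s)).trans
    (ENNReal.ofReal_le_ofReal (norm_sub_le_norm_sub_add_norm_sub _ _ _))

/-- The adapted Wasserstein distance is a finite pseudometric on Gaussian processes. -/
noncomputable abbrev gaussianPseudoMetric : PseudoMetricSpace (gaussianProcesses G) :=
  letI : PseudoEMetricSpace (gaussianProcesses G) :=
    { edist := fun X Y => gaussianAW P G hG X.1 Y.1
      edist_self := by
        rintro ⟨X, hX⟩
        obtain ⟨v, rfl⟩ := exists_gaussianPath_eq hX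
        simpa using gaussianAW_gaussianPath_le hG hlaw hindep v v
      edist_comm := by
        rintro ⟨X, hX⟩ ⟨Y, hY⟩
        obtain ⟨v, rfl⟩ := exists_gaussianPath_eq hX
        obtain ⟨w, rfl⟩ := exists_gaussianPath_eq hY
        exact (gaussianAW_gaussianPath_comm_le hG hlaw hindep v w).antisymm
          (gaussianAW_gaussianPath_comm_le hG hlaw hindep w v)
      edist_triangle := by
        rintro ⟨X, hX⟩ ⟨Y, hY⟩ ⟨Z, hZ⟩
        obtain ⟨u, rfl⟩ := exists_gaussianPath_eq hX
        obtain ⟨v, rfl⟩ := exists_gaussianPath_eq hY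
        obtain ⟨w, rfl⟩ := exists_gaussianPath_eq hZ
        exact gaussianAW_gaussianPath_triangle hG hlaw hindep u v w }
  PseudoEMetricSpace.toPseudoMetricSpace (by
    rintro ⟨X, hX⟩ ⟨Y, hY⟩
    obtain ⟨v, rfl⟩ := exists_gaussianPath_eq hX
    obtain ⟨w, rfl⟩ := exists_gaussianPath_eq hY
    exact ((gaussianAW_gaussianPath_le hG hlaw hindep v w).trans_lt ENNReal.ofReal_lt_top).ne)

/-- The adapted Wasserstein distance induces a metric on the space of Gaussian processes. -/
lemma exists_metricSpace_gaussianProcessSpace :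
    ∃ _ : MetricSpace (GaussianProcessSpace P G hG), ∀ X Y : gaussianProcesses G,
      edist (GaussianProcessSpace.mk P G hG X) (GaussianProcessSpace.mk P G hG Y) =
        gaussianAW P G hG X.1 Y.1 :=
  @exists_metricSpace_quot _ (gaussianPseudoMetric hG hlaw hindep) _ fun _ _ => Iff.rfl

end Metric

theorem theorem2p3 {d T : ℕ} [NeZero T]
    {Ω : Type*} [MeasurableSpace Ω] [StandardBorelSpace Ω]
    (P : Measure Ω) [IsProbabilityMeasure P]
    (G : Fin T → Ω → EuclideanSpace ℝ (Fin d)) (hG : ∀ t, Measurable (G t))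
    (hlaw : ∀ t, P.map (G t) = stdGaussian (EuclideanSpace ℝ (Fin d)))
    (hindep : iIndepFun G P) :
    ∃ _ : MetricSpace (GaussianProcessSpace P G hG),
      (∀ X Y : gaussianProcesses G,
        edist (GaussianProcessSpace.mk P G hG X) (GaussianProcessSpace.mk P G hG Y) =
          gaussianAW P G hG X.1 Y.1) ∧
      IsNonnegCurvedAlexandrov (GaussianProcessSpace P G hG) := by
  obtain ⟨m, hm⟩ := exists_metricSpace_gaussianProcessSpace hG hlaw hindep
  refine ⟨m, hm, isNonnegCurvedAlexandrov_of_submetry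
    (fun v : gaussianParams d T => GaussianProcessSpace.mk P G hG ⟨_, gaussianPath_mem G v⟩)
    ?_ (fun v w => ?_) fun v w => ?_⟩
  · rintro ⟨X, hX⟩
    obtain ⟨v, rfl⟩ := exists_gaussianPath_eq hX
    exact ⟨v, rfl⟩
  · rw [dist_edist, hm]
    exact ENNReal.toReal_le_of_le_ofReal (norm_nonneg _)
      (gaussianAW_gaussianPath_le hG hlaw hindep v w)
  · obtain ⟨⟨O, hO, h⟩, -⟩ := gaussianAW_gaussianPath hG hlaw hindep v w
    -- The optimal lift is `w` moved along its orbit by the minimizing rotation.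
    refine ⟨rotate O w, Quot.sound (gaussianAW_rotate_self hG hlaw hindep hO w), ?_⟩
    rw [dist_edist, hm, h, ENNReal.toReal_ofReal (norm_nonneg _)]
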